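/- Let $n\ge 1$. A quantum state on $\mathbb C^n$ is a positive semidefinite $n\times n$ complex matrix of trace $1$. A rank-one POVM on $\mathbb C^n$ is a finite family $M=(M_i)$ of positive semidefinite $n\times n$ complex matrices of rank one with $\sum_i M_i=I$. It is called a $4$-design if $$\sum_i p_i\,P_i^{\otimes 4}=\int d\psi\,|\psi\rangle\langle\psi|^{\otimes 4},\qquad p_i=\tfrac1n\operatorname{tr}M_i,\quad P_i=\tfrac{1}{\operatorname{tr}M_i}M_i,$$ where the integral is over the uniform (unitarily invariant) probability measure on the unit sphere of $\mathbb C^n$. For a matrix $X$ put $\|X\|_M=\sum_i|\operatorname{tr}(M_iX)|$. **Theorem.** Let $M$ be a $4$-design POVM on $\mathbb C^n$, let $\rho,\sigma$ be quantum states on $\mathbb C^n$, let $0\le p\le 1$, and set $\Delta=p\rho-(1-p)\sigma$. Then $$\|\Delta\|_M\ \ge\ \frac{1}{9\,(1+1/n)^{1/2}}\Bigl((1-2p)^2+\operatorname{tr}\Delta^2\Bigr)^{1/2}.$$ -/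

import Mathlib

open MeasureTheory
open scoped ComplexOrder

namespace QuantumDesign

/-- A density matrix: the matrix of a quantum state on `ℂ^n`. -/
structure IsState {n : ℕ} (ρ : Matrix (Fin n) (Fin n) ℂ) : Prop where
  posSemidef : ρ.PosSemidef
  trace_eq_one : ρ.trace = 1

/-- A POVM on `ℂ^n`: a partition of the identity into positive operators. -/
structure IsPOVM {n : ℕ} {ι : Type*} [Fintype ι] (M : ι → Matrix (Fin n) (Fin n) ℂ) : Prop where
  posSemidef : ∀ i, (M i).PosSemidef
  sum_eq_one : ∑ i, M i = 1

/-- The `t`-fold tensor power `A ⊗ ⋯ ⊗ A`, in the product basis of `(ℂ^n)^{⊗ t}`. -/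
def tensorPow {n : ℕ} (t : ℕ) (A : Matrix (Fin n) (Fin n) ℂ) :
    Matrix (Fin t → Fin n) (Fin t → Fin n) ℂ :=
  Matrix.of fun a b => ∏ k, A (a k) (b k)

/-- The unit sphere of the Hilbert space `ℂ^n`. -/
abbrev unitSphere (n : ℕ) : Set (EuclideanSpace ℂ (Fin n)) := Metric.sphere 0 1

/-- The rank-one projector `|ψ⟩⟨ψ|` onto a unit vector `ψ`. -/
def proj {n : ℕ} (ψ : unitSphere n) : Matrix (Fin n) (Fin n) ℂ :=
  Matrix.vecMulVec (fun a => ψ.1 a) (fun b => star (ψ.1 b))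

/-- The uniform measure on the unit sphere of `ℂ^n`: the surface measure induced by Lebesgue
measure on `ℂ^n ≅ ℝ^{2n}`, normalised to total mass `1`. -/
noncomputable def haarSphere (n : ℕ) : Measure (unitSphere n) :=
  ((volume : Measure (EuclideanSpace ℂ (Fin n))).toSphere Set.univ)⁻¹ •
    (volume : Measure (EuclideanSpace ℂ (Fin n))).toSphere

/-- The operator `∫ dψ |ψ⟩⟨ψ|^{⊗ t}` on `(ℂ^n)^{⊗ t}`, integrated entry by entry. -/
noncomputable def haarMoment (n t : ℕ) : Matrix (Fin t → Fin n) (Fin t → Fin n) ℂ :=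
  Matrix.of fun a b => ∫ ψ, tensorPow t (proj ψ) a b ∂(haarSphere n)

/-- A `t`-design POVM: a rank-one POVM `M` with `∑ i, p_i P_i^{⊗ t} = ∫ dψ |ψ⟩⟨ψ|^{⊗ t}`, where
`p_i = (1/n) tr M_i` and `P_i = M_i / tr M_i`. -/
structure IsDesign {n : ℕ} {ι : Type*} [Fintype ι] (t : ℕ)
    (M : ι → Matrix (Fin n) (Fin n) ℂ) : Prop where
  isPOVM : IsPOVM M
  rank_eq_one : ∀ i, (M i).rank = 1
  moment_eq :
    ∑ i, ((1 / (n : ℂ)) * (M i).trace) • tensorPow t ((1 / (M i).trace) • M i) = haarMoment n t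

/-- `‖X‖_M = ∑ i, |tr (M_i X)|`. -/
noncomputable def measNorm {n : ℕ} {ι : Type*} [Fintype ι] (M : ι → Matrix (Fin n) (Fin n) ℂ)
    (X : Matrix (Fin n) (Fin n) ℂ) : ℝ :=
  ∑ i, ‖(M i * X).trace‖

end QuantumDesign

/-! Let S take the value tr(P_i Δ) with probability p_i, so that ‖Δ‖_M = n E|S|. Pairing the design
identity with Δ⊗Δ⊗1⊗1 and with Δ^{⊗4} shows that S has the same second and fourth moments as ⟨ψ, Δψ⟩
for uniform ψ (`IsDesign.sum_sq`, `IsDesign.sum_pow_four`).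

The sphere moments come from Gaussian integrals: polar coordinates remove the radius, and
diagonalising Δ turns the quadratic form into ∑ λ_i |z_i|² with |z_i|² independent standard
exponentials. This gives E S² = ((tr Δ)² + tr Δ²)/(n(n+1)), and E S⁴ in terms of power sums of
eigenvalues, whence E S⁴ ≤ 81 (E S²)². A variable with this property satisfies E|S| ≥ √(E S²)/9
(`sqrt_second_moment_le_of_fourth_moment_le`). Finally tr Δ = 2p - 1. -/

namespace QuantumDesign

open ProbabilityTheory

/-! ### Gaussian measure on ℂ and its radial moments -/

/-- The standard complex Gaussian measure on `ℂ`, of density `exp (-|z|²) / π`. -/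
noncomputable def complexGaussian : Measure ℂ :=
  volume.withDensity fun z => ENNReal.ofReal (Real.pi⁻¹ * Real.exp (-‖z‖ ^ 2))

lemma integral_norm_pow_mul_exp_neg_norm_sq (j : ℕ) :
    ∫ z : ℂ, ‖z‖ ^ (2 * j) * Real.exp (-‖z‖ ^ 2) = Real.pi * (j.factorial : ℝ) := by
  have h := Complex.integral_rpow_mul_exp_neg_rpow (p := 2) (q := ((2 * j : ℕ) : ℝ)) (by norm_num)
    (by have : (0 : ℝ) ≤ ((2 * j : ℕ) : ℝ) := Nat.cast_nonneg _
        linarith)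
  have h2 : (((2 * j : ℕ) : ℝ) + 2) / 2 = (j : ℝ) + 1 := by push_cast; ring
  rw [h2, Real.Gamma_nat_eq_factorial] at h
  simp only [Real.rpow_natCast] at h
  rw [mul_div_cancel_left₀ _ (two_ne_zero)] at h
  rw [← h]
  congr 1
  ext z
  rw [← Real.rpow_natCast ‖z‖ 2]
  norm_num

lemma integrable_norm_pow_mul_exp_neg_norm_sq (j : ℕ) :
    Integrable fun z : ℂ => ‖z‖ ^ (2 * j) * Real.exp (-‖z‖ ^ 2) := by
  -- The integral of a non-integrable function is 0 by convention, so a nonzero value proves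
  -- integrability.
  apply Integrable.of_integral_ne_zero
  rw [integral_norm_pow_mul_exp_neg_norm_sq]
  positivity

lemma measurable_gaussian_density :
    Measurable fun z : ℂ => Real.toNNReal (Real.pi⁻¹ * Real.exp (-‖z‖ ^ 2)) := by
  fun_prop

lemma integral_complexGaussian (f : ℂ → ℝ) :
    ∫ z, f z ∂complexGaussian = Real.pi⁻¹ * ∫ z, f z * Real.exp (-‖z‖ ^ 2) := by
  unfold complexGaussian
  simp only [ENNReal.ofReal]
  rw [integral_withDensity_eq_integral_smul measurable_gaussian_density, ← integral_const_mul]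
  congr 1
  ext z
  rw [NNReal.smul_def, Real.coe_toNNReal _ (by positivity), smul_eq_mul]
  ring

lemma integrable_complexGaussian_iff (f : ℂ → ℝ) :
    Integrable f complexGaussian ↔ Integrable fun z => f z * Real.exp (-‖z‖ ^ 2) := by
  unfold complexGaussian
  simp only [ENNReal.ofReal]
  rw [integrable_withDensity_iff_integrable_smul measurable_gaussian_density,
    ← integrable_const_mul_iff (c := Real.pi⁻¹) (by simp [Real.pi_ne_zero])
      fun z => f z * Real.exp (-‖z‖ ^ 2)]
  apply iff_of_eq
  congr 1
  ext z
  rw [NNReal.smul_def, Real.coe_toNNReal _ (by positivity), smul_eq_mul]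
  ring

instance : IsProbabilityMeasure complexGaussian where
  measure_univ := by
    unfold complexGaussian
    rw [withDensity_apply _ MeasurableSet.univ, Measure.restrict_univ,
      ← ofReal_integral_eq_lintegral_ofReal _ (ae_of_all _ fun z => by positivity)]
    · have := integral_norm_pow_mul_exp_neg_norm_sq 0
      simp only [mul_zero, pow_zero, one_mul, Nat.factorial_zero, Nat.cast_one, mul_one] at this
      rw [integral_const_mul, this, inv_mul_cancel₀ Real.pi_ne_zero, ENNReal.ofReal_one]
    · have := integrable_norm_pow_mul_exp_neg_norm_sq 0
      simp only [mul_zero, pow_zero, one_mul] at this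
      exact this.const_mul _

lemma integrable_norm_sq_pow_complexGaussian (j : ℕ) :
    Integrable (fun z : ℂ => (‖z‖ ^ 2) ^ j) complexGaussian := by
  rw [integrable_complexGaussian_iff]
  simpa only [← pow_mul] using integrable_norm_pow_mul_exp_neg_norm_sq j

lemma integral_norm_sq_pow_complexGaussian (j : ℕ) :
    ∫ z : ℂ, (‖z‖ ^ 2) ^ j ∂complexGaussian = j.factorial := by
  rw [integral_complexGaussian]
  simp only [← pow_mul]
  rw [integral_norm_pow_mul_exp_neg_norm_sq, inv_mul_cancel_left₀ Real.pi_ne_zero]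

/-! ### Moments of sums of independent variables -/

section Moments

variable {Ω : Type*} [MeasurableSpace Ω] {μ : Measure Ω}

lemma integrable_pow_mul_pow_of_indepFun {Y Z : Ω → ℝ} (h : IndepFun Y Z μ)
    (hY : ∀ k : ℕ, Integrable (fun ω => Y ω ^ k) μ)
    (hZ : ∀ k : ℕ, Integrable (fun ω => Z ω ^ k) μ) (j k : ℕ) :
    Integrable (fun ω => Y ω ^ j * Z ω ^ k) μ :=
  (h.comp (φ := fun x => x ^ j) (ψ := fun x => x ^ k) (by fun_prop) (by fun_prop)).integrable_mul
    (hY j) (hZ k)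

lemma integral_add_pow_of_indepFun {Y Z : Ω → ℝ} (h : IndepFun Y Z μ)
    (hY : ∀ k : ℕ, Integrable (fun ω => Y ω ^ k) μ)
    (hZ : ∀ k : ℕ, Integrable (fun ω => Z ω ^ k) μ) (k : ℕ) :
    ∫ ω, (Y ω + Z ω) ^ k ∂μ = ∑ m ∈ Finset.range (k + 1),
      (∫ ω, Y ω ^ m ∂μ) * (∫ ω, Z ω ^ (k - m) ∂μ) * (k.choose m) := by
  simp only [add_pow]
  rw [integral_finsetSum _ fun m _ => (integrable_pow_mul_pow_of_indepFun h hY hZ _ _).mul_const _]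
  refine Finset.sum_congr rfl fun m _ => ?_
  rw [integral_mul_const]
  congr 1
  exact (h.comp (φ := fun x => x ^ m) (ψ := fun x => x ^ (k - m)) (by fun_prop)
    (by fun_prop)).integral_mul_eq_mul_integral (hY m).aestronglyMeasurable
    (hZ _).aestronglyMeasurable

lemma integrable_add_pow_of_indepFun {Y Z : Ω → ℝ} (h : IndepFun Y Z μ)
    (hY : ∀ k : ℕ, Integrable (fun ω => Y ω ^ k) μ)
    (hZ : ∀ k : ℕ, Integrable (fun ω => Z ω ^ k) μ) (k : ℕ) :
    Integrable (fun ω => (Y ω + Z ω) ^ k) μ := by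
  simp only [add_pow]
  exact integrable_finsetSum _
    fun m _ => (integrable_pow_mul_pow_of_indepFun h hY hZ _ _).mul_const _

/-- The moments up to order four of a linear combination of independent standard exponential
variables, in terms of the power sums of the coefficients. -/
lemma moments_sum_exponential [IsProbabilityMeasure μ] {κ : Type*} {X : κ → Ω → ℝ}
    (hX : iIndepFun X μ) (hm : ∀ i, Measurable (X i))
    (hint : ∀ i (k : ℕ), Integrable (fun ω => X i ω ^ k) μ)
    (hmom : ∀ i (k : ℕ), ∫ ω, X i ω ^ k ∂μ = k.factorial) (c : κ → ℝ) (s : Finset κ) :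
    (∀ k : ℕ, Integrable (fun ω => (∑ i ∈ s, c i * X i ω) ^ k) μ) ∧
    (∫ ω, (∑ i ∈ s, c i * X i ω) ^ 1 ∂μ = ∑ i ∈ s, c i) ∧
    (∫ ω, (∑ i ∈ s, c i * X i ω) ^ 2 ∂μ = (∑ i ∈ s, c i) ^ 2 + ∑ i ∈ s, c i ^ 2) ∧
    (∫ ω, (∑ i ∈ s, c i * X i ω) ^ 3 ∂μ = (∑ i ∈ s, c i) ^ 3
      + 3 * (∑ i ∈ s, c i) * (∑ i ∈ s, c i ^ 2) + 2 * ∑ i ∈ s, c i ^ 3) ∧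
    (∫ ω, (∑ i ∈ s, c i * X i ω) ^ 4 ∂μ = (∑ i ∈ s, c i) ^ 4
      + 6 * (∑ i ∈ s, c i) ^ 2 * (∑ i ∈ s, c i ^ 2) + 3 * (∑ i ∈ s, c i ^ 2) ^ 2
      + 8 * (∑ i ∈ s, c i) * (∑ i ∈ s, c i ^ 3) + 6 * ∑ i ∈ s, c i ^ 4) := by
  classical
  -- The binomial expansion of each moment uses all lower ones, so orders 1 and 3 are carried along
  -- with 2 and 4.
  induction s using Finset.induction_on with
  | empty =>
    refine ⟨fun k => ?_, ?_⟩
    · simp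
    · simp
  | insert a s ha ih =>
    obtain ⟨hi, h1, h2, h3, h4⟩ := ih
    have hind : IndepFun (fun ω => ∑ i ∈ s, c i * X i ω) (fun ω => c a * X a ω) μ := by
      have := (hX.comp (fun i x => c i * x) (fun i => by fun_prop)).indepFun_finsetSum_of_notMem
        (fun i => (hm i).const_mul (c i)) ha
      convert this using 1
      · ext ω
        simp
      · rfl
    have hZ : ∀ k : ℕ, Integrable (fun ω => (c a * X a ω) ^ k) μ := fun k => by
      simp only [mul_pow]
      exact (hint a k).const_mul _
    have hZm : ∀ k : ℕ, ∫ ω, (c a * X a ω) ^ k ∂μ = c a ^ k * k.factorial := fun k => by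
      simp only [mul_pow]
      rw [integral_const_mul, hmom]
    have hcomm : ∀ ω, ∑ i ∈ insert a s, c i * X i ω = ∑ i ∈ s, c i * X i ω + c a * X a ω :=
      fun ω => by rw [Finset.sum_insert ha, add_comm]
    simp only [hcomm, Finset.sum_insert ha]
    refine ⟨integrable_add_pow_of_indepFun hind hi hZ, ?_, ?_, ?_, ?_⟩ <;>
    · rw [integral_add_pow_of_indepFun hind hi hZ]
      simp only [Finset.sum_range_succ, Finset.sum_range_zero, hZm, h1, h2, h3, h4]
      simp [Nat.factorial, Nat.choose]
      try ring

end Moments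

lemma moments_pi_complexGaussian {κ : Type*} [Fintype κ] (c : κ → ℝ) :
    (∫ z, (∑ i, c i * ‖z i‖ ^ 2) ^ 2 ∂(Measure.pi fun _ : κ => complexGaussian)
      = (∑ i, c i) ^ 2 + ∑ i, c i ^ 2) ∧
    (∫ z, (∑ i, c i * ‖z i‖ ^ 2) ^ 4 ∂(Measure.pi fun _ : κ => complexGaussian)
      = (∑ i, c i) ^ 4
      + 6 * (∑ i, c i) ^ 2 * (∑ i, c i ^ 2) + 3 * (∑ i, c i ^ 2) ^ 2
      + 8 * (∑ i, c i) * (∑ i, c i ^ 3) + 6 * ∑ i, c i ^ 4) := by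
  have hX : iIndepFun (fun (i : κ) (z : κ → ℂ) => ‖z i‖ ^ 2)
      (Measure.pi fun _ : κ => complexGaussian) :=
    iIndepFun_pi (X := fun _ z => ‖z‖ ^ 2) (fun i => by fun_prop)
  obtain ⟨-, -, h2, -, h4⟩ := moments_sum_exponential hX (fun i => by fun_prop)
    (fun i k => (measurePreserving_eval (fun _ : κ => complexGaussian)
      i).integrable_comp_of_integrable (g := fun z : ℂ => (‖z‖ ^ 2) ^ k) (integrable_norm_sq_pow_complexGaussian k))
    (fun i k => by
      rw [← integral_norm_sq_pow_complexGaussian k]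
      exact integral_comp_eval (μ := fun _ : κ => complexGaussian)
        (integrable_norm_sq_pow_complexGaussian k).aestronglyMeasurable) c Finset.univ
  exact ⟨h2, h4⟩

/-! ### From Gaussian integrals to the sphere -/

/-- Polar coordinates for the Gaussian integral of a homogeneous function. -/
lemma integral_homogeneous_mul_exp_neg_norm_sq {E : Type*} [NormedAddCommGroup E]
    [NormedSpace ℝ E] [MeasurableSpace E] [BorelSpace E] [FiniteDimensional ℝ E] [Nontrivial E]
    (μ : Measure E) [μ.IsAddHaarMeasure] {f : E → ℝ} {m : ℕ}
    (hf : ∀ (r : ℝ) (x : E), f (r • x) = r ^ m * f x) :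
    ∫ x, f x * Real.exp (-‖x‖ ^ 2) ∂μ = (∫ x : Metric.sphere (0 : E) 1, f x ∂μ.toSphere) *
      ∫ r : Set.Ioi (0 : ℝ), r.1 ^ m * Real.exp (-r.1 ^ 2)
        ∂(Measure.volumeIoiPow (Module.finrank ℝ E - 1)) := by
  have h := μ.measurePreserving_homeomorphUnitSphereProd.integral_comp
    (Homeomorph.measurableEmbedding _)
    fun p => f p.1.1 * (p.2.1 ^ m * Real.exp (-p.2.1 ^ 2))
  rw [integral_prod_mul (fun x : Metric.sphere (0 : E) 1 => f x)
    fun r : Set.Ioi (0 : ℝ) => r.1 ^ m * Real.exp (-r.1 ^ 2)] at h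
  -- The origin, where polar coordinates break down, is a null set.
  rw [← h, ← restrict_compl_singleton (μ := μ) 0,
    ← integral_subtype_comap (measurableSet_singleton _).compl
      fun x => f x * Real.exp (-‖x‖ ^ 2), restrict_compl_singleton]
  refine integral_congr_ae (.of_forall fun x => ?_)
  have hx : ‖(x : E)‖ ≠ 0 := norm_ne_zero_iff.2 x.2
  simp only [homeomorphUnitSphereProd_apply_snd_coe, homeomorphUnitSphereProd_apply_fst_coe]
  rw [hf, inv_pow]
  field_simp

lemma prod_gaussian_density {n : ℕ} (z : Fin n → ℂ) :
    ∏ i, (Real.pi⁻¹ * Real.exp (-‖z i‖ ^ 2)) =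
      Real.pi⁻¹ ^ n * Real.exp (-‖(WithLp.toLp 2 z : EuclideanSpace ℂ (Fin n))‖ ^ 2) := by
  rw [Finset.prod_mul_distrib, ← Real.exp_sum, EuclideanSpace.norm_sq_eq]
  simp

lemma integrable_prod_gaussian_density (n : ℕ) :
    Integrable fun z : Fin n → ℂ => ∏ i, (Real.pi⁻¹ * Real.exp (-‖z i‖ ^ 2)) := by
  refine Integrable.fintype_prod (μ := fun _ => volume)
    (f := fun _ (z : ℂ) => Real.pi⁻¹ * Real.exp (-‖z‖ ^ 2)) fun i => ?_
  have := integrable_norm_pow_mul_exp_neg_norm_sq 0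
  simp only [mul_zero, pow_zero, one_mul] at this
  exact this.const_mul _

lemma pi_complexGaussian (n : ℕ) :
    Measure.pi (fun _ : Fin n => complexGaussian) =
      volume.withDensity fun z : Fin n → ℂ =>
        ENNReal.ofReal (∏ i, (Real.pi⁻¹ * Real.exp (-‖z i‖ ^ 2))) := by
  refine Measure.pi_eq fun s hs => ?_
  have key : ∀ i, complexGaussian (s i) = ENNReal.ofReal
      (∫ z, (s i).indicator (fun z => Real.pi⁻¹ * Real.exp (-‖z‖ ^ 2)) z) := fun i => by
    unfold complexGaussian
    rw [withDensity_apply _ (hs i), integral_indicator (hs i),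
      ofReal_integral_eq_lintegral_ofReal _ (ae_of_all _ fun z => by positivity)]
    have := integrable_norm_pow_mul_exp_neg_norm_sq 0
    simp only [mul_zero, pow_zero, one_mul] at this
    exact (this.const_mul _).integrableOn
  simp only [key]
  rw [← ENNReal.ofReal_prod_of_nonneg fun i _ => integral_nonneg fun z =>
      Set.indicator_nonneg (fun z _ => by positivity) z,
    ← integral_fintype_prod_volume_eq_prod,
    withDensity_apply _ (MeasurableSet.univ_pi hs),
    ← ofReal_integral_eq_lintegral_ofReal (integrable_prod_gaussian_density n).integrableOn
      (ae_of_all _ fun z => Finset.prod_nonneg fun i _ => by positivity),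
    ← integral_indicator (MeasurableSet.univ_pi hs)]
  congr 2
  ext z
  by_cases hz : z ∈ Set.univ.pi s
  · rw [Set.indicator_of_mem hz]
    exact Finset.prod_congr rfl fun i _ => (Set.indicator_of_mem (hz i trivial)
      fun z => Real.pi⁻¹ * Real.exp (-‖z‖ ^ 2)).symm
  · rw [Set.indicator_of_notMem hz]
    simp only [Set.mem_pi, Set.mem_univ, true_implies, not_forall] at hz
    obtain ⟨i, hi⟩ := hz
    exact (Finset.prod_eq_zero (Finset.mem_univ i) (Set.indicator_of_notMem hi _)).symm

lemma integral_pi_complexGaussian (n : ℕ) (f : (Fin n → ℂ) → ℝ) :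
    ∫ z, f z ∂(Measure.pi fun _ : Fin n => complexGaussian) = Real.pi⁻¹ ^ n *
      ∫ z, f z * Real.exp (-‖(WithLp.toLp 2 z : EuclideanSpace ℂ (Fin n))‖ ^ 2) := by
  rw [pi_complexGaussian]
  simp only [ENNReal.ofReal]
  rw [integral_withDensity_eq_integral_smul (by fun_prop), ← integral_const_mul]
  congr 1
  ext z
  rw [NNReal.smul_def, Real.coe_toNNReal _ (Finset.prod_nonneg fun i _ => by positivity),
    smul_eq_mul, prod_gaussian_density]
  ring

/-- Uniqueness of Haar measure up to scale relates the two volumes. The value of c is irrelevant: it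
cancels in the ratio taken in `integral_haarSphere_quadForm_pow`. -/
lemma exists_integral_euclidean_eq_integral_pi_complexGaussian (n : ℕ) :
    ∃ c : ℝ, c ≠ 0 ∧ ∀ f : EuclideanSpace ℂ (Fin n) → ℝ,
      ∫ z, f z * Real.exp (-‖z‖ ^ 2) =
        c * ∫ z, f (WithLp.toLp 2 z) ∂(Measure.pi fun _ : Fin n => complexGaussian) := by
  let e : (Fin n → ℂ) ≃L[ℝ] EuclideanSpace ℂ (Fin n) := PiLp.continuousLinearEquiv 2 ℝ _ |>.symm
  have : (Measure.map e volume).IsAddHaarMeasure := e.isAddHaarMeasure_map volume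
  have h := Measure.isAddLeftInvariant_eq_smul (volume : Measure (EuclideanSpace ℂ (Fin n)))
    (Measure.map e volume)
  have hc := Measure.addHaarScalarFactor_pos_of_isAddHaarMeasure
    (volume : Measure (EuclideanSpace ℂ (Fin n))) (Measure.map e volume)
  have he : MeasurableEmbedding e := e.toHomeomorph.measurableEmbedding
  generalize Measure.addHaarScalarFactor (volume : Measure (EuclideanSpace ℂ (Fin n)))
    (Measure.map e volume) = c at h hc
  refine ⟨c * Real.pi ^ n, by positivity, fun f => ?_⟩
  rw [integral_pi_complexGaussian, h, integral_smul_nnreal_measure, NNReal.smul_def, smul_eq_mul,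
    mul_assoc, ← mul_assoc (_ ^ n),
    ← mul_pow, mul_inv_cancel₀ Real.pi_ne_zero, one_pow, one_mul,
    he.integral_map]
  rfl

/-! ### Quadratic forms of Hermitian matrices -/

section Hermitian

variable {n : ℕ} {A : Matrix (Fin n) (Fin n) ℂ}

lemma star_dotProduct_mulVec_eq_sum_eigenvalues (hA : A.IsHermitian)
    (z : EuclideanSpace ℂ (Fin n)) :
    star z.ofLp ⬝ᵥ A.mulVec z.ofLp =
      ((∑ i, hA.eigenvalues i * ‖hA.eigenvectorBasis.repr z i‖ ^ 2 : ℝ) : ℂ) := by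
  have h1 : star z.ofLp ⬝ᵥ A.mulVec z.ofLp = inner ℂ z (WithLp.toLp 2 (A.mulVec z.ofLp)) := by
    rw [EuclideanSpace.inner_eq_star_dotProduct, dotProduct_comm]
  rw [h1, ← hA.eigenvectorBasis.sum_inner_mul_inner]
  push_cast
  refine Finset.sum_congr rfl fun i _ => ?_
  have h2 : inner ℂ (hA.eigenvectorBasis i) (WithLp.toLp 2 (A.mulVec z.ofLp)) =
      hA.eigenvalues i * inner ℂ (hA.eigenvectorBasis i) z := by
    rw [EuclideanSpace.inner_eq_star_dotProduct, EuclideanSpace.inner_eq_star_dotProduct,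
      dotProduct_comm, Matrix.dotProduct_mulVec, dotProduct_comm z.ofLp]
    have h3 : Matrix.vecMul (star (hA.eigenvectorBasis i).ofLp) A =
        (hA.eigenvalues i : ℂ) • star (hA.eigenvectorBasis i).ofLp := by
      have h4 := congrArg star (hA.mulVec_eigenvectorBasis i)
      rw [Matrix.star_mulVec, hA.eq] at h4
      rw [h4]
      ext j
      simp
    rw [h3, smul_dotProduct, smul_eq_mul]
  rw [h2, OrthonormalBasis.repr_apply_apply, ← inner_conj_symm z, mul_left_comm, RCLike.conj_mul]
  rfl

lemma sum_eigenvalues_pow (hA : A.IsHermitian) (k : ℕ) :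
    ((∑ i, hA.eigenvalues i ^ k : ℝ) : ℂ) = (A ^ k).trace := by
  conv_rhs => rw [hA.spectral_theorem, ← map_pow, Unitary.conjStarAlgAut_apply,
    Matrix.trace_mul_cycle, Unitary.coe_star_mul_self, one_mul, Matrix.diagonal_pow,
    Matrix.trace_diagonal]
  simp

/-- The map `z ↦ ⟨z, A z⟩`, real-valued for Hermitian `A`. -/
noncomputable def quadForm (A : Matrix (Fin n) (Fin n) ℂ) (z : EuclideanSpace ℂ (Fin n)) : ℝ :=
  (star z.ofLp ⬝ᵥ A.mulVec z.ofLp).re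

lemma quadForm_smul (r : ℝ) (z : EuclideanSpace ℂ (Fin n)) :
    quadForm A (r • z) = r ^ 2 * quadForm A z := by
  have : (r • z).ofLp = (r : ℂ) • z.ofLp := by ext; simp
  unfold quadForm
  rw [this, Matrix.mulVec_smul, star_smul, smul_dotProduct, dotProduct_smul]
  simp [smul_eq_mul]
  ring

lemma ofReal_quadForm (hA : A.IsHermitian) (z : EuclideanSpace ℂ (Fin n)) :
    (quadForm A z : ℂ) = star z.ofLp ⬝ᵥ A.mulVec z.ofLp := by
  unfold quadForm
  rw [star_dotProduct_mulVec_eq_sum_eigenvalues hA, Complex.ofReal_re]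

/-- Passing to eigenvector coordinates is an isometry, so it preserves both the volume and the
Gaussian weight. -/
lemma integral_quadForm_pow_mul_exp (hA : A.IsHermitian) (k : ℕ) :
    ∫ z, quadForm A z ^ k * Real.exp (-‖z‖ ^ 2) =
      ∫ z : EuclideanSpace ℂ (Fin n), (∑ i, hA.eigenvalues i * ‖z i‖ ^ 2) ^ k *
        Real.exp (-‖z‖ ^ 2) := by
  let e : EuclideanSpace ℂ (Fin n) ≃ₗᵢ[ℝ] EuclideanSpace ℂ (Fin n) :=
    { hA.eigenvectorBasis.repr.toLinearEquiv.restrictScalars ℝ with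
      norm_map' := hA.eigenvectorBasis.repr.norm_map }
  have h := e.measurePreserving.integral_comp e.toHomeomorph.measurableEmbedding
    fun z => (∑ i, hA.eigenvalues i * ‖z i‖ ^ 2) ^ k * Real.exp (-‖z‖ ^ 2)
  rw [← h]
  congr 1
  ext z
  rw [e.norm_map]
  unfold quadForm
  rw [star_dotProduct_mulVec_eq_sum_eigenvalues hA, Complex.ofReal_re]
  rfl

lemma integral_haarSphere (f : unitSphere n → ℝ) :
    ∫ ψ, f ψ ∂(haarSphere n) =
      ((volume : Measure (EuclideanSpace ℂ (Fin n))).toSphere.real Set.univ)⁻¹ *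
        ∫ ψ, f ψ ∂(volume : Measure (EuclideanSpace ℂ (Fin n))).toSphere := by
  unfold haarSphere
  rw [integral_smul_measure, ENNReal.toReal_inv, smul_eq_mul, Measure.real]

/-- The functions ⟨z, Az⟩^k and ‖z‖^{2k} have the same degree, hence the same radial factor, and the
second is 1 on the sphere. Dividing one Gaussian integral by the other leaves the spherical average,
with no constant to evaluate. -/
lemma integral_haarSphere_quadForm_pow [NeZero n] (hA : A.IsHermitian) (k : ℕ)
    (hk : ∫ z, (∑ i, (1 : ℝ) * ‖z i‖ ^ 2) ^ k
      ∂(Measure.pi fun _ : Fin n => complexGaussian) ≠ 0) :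
    ∫ ψ, quadForm A ψ.1 ^ k ∂(haarSphere n) =
      (∫ z, (∑ i, hA.eigenvalues i * ‖z i‖ ^ 2) ^ k
        ∂(Measure.pi fun _ : Fin n => complexGaussian)) /
      ∫ z, (∑ i, (1 : ℝ) * ‖z i‖ ^ 2) ^ k ∂(Measure.pi fun _ : Fin n => complexGaussian) := by
  obtain ⟨c, hc, hcf⟩ := exists_integral_euclidean_eq_integral_pi_complexGaussian n
  have h1 := integral_homogeneous_mul_exp_neg_norm_sq
    (volume : Measure (EuclideanSpace ℂ (Fin n))) (f := fun z => quadForm A z ^ k) (m := 2 * k)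
    (fun r x => by rw [quadForm_smul, mul_pow, pow_mul])
  have h2 := integral_homogeneous_mul_exp_neg_norm_sq
    (volume : Measure (EuclideanSpace ℂ (Fin n))) (f := fun z => (‖z‖ ^ 2) ^ k) (m := 2 * k)
    (fun r x => by rw [norm_smul, mul_pow, mul_pow, Real.norm_eq_abs, sq_abs, pow_mul])
  rw [integral_quadForm_pow_mul_exp hA, hcf] at h1
  rw [hcf] at h2
  simp only [EuclideanSpace.norm_sq_eq, norm_eq_of_mem_sphere, one_pow, integral_const, smul_eq_mul,
    mul_one, one_mul] at h1 h2 hk ⊢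
  rw [integral_haarSphere]
  set C := ∫ r : Set.Ioi (0 : ℝ), r.1 ^ (2 * k) * Real.exp (-r.1 ^ 2)
        ∂(Measure.volumeIoiPow (Module.finrank ℝ (EuclideanSpace ℂ (Fin n)) - 1))
  set R := (volume : Measure (EuclideanSpace ℂ (Fin n))).toSphere.real Set.univ
  set S := ∫ ψ : unitSphere n, quadForm A ψ.1 ^ k
    ∂(volume : Measure (EuclideanSpace ℂ (Fin n))).toSphere
  set I := ∫ z, (∑ i, hA.eigenvalues i * ‖z i‖ ^ 2) ^ k
    ∂(Measure.pi fun _ : Fin n => complexGaussian)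
  set I₁ := ∫ z, (∑ i, ‖z i‖ ^ 2) ^ k ∂(Measure.pi fun _ : Fin n => complexGaussian)
  rw [eq_div_iff hk]
  apply mul_left_cancel₀ hc
  have hR : R ≠ 0 := fun h0 => mul_ne_zero hc hk (by rw [h2, h0, zero_mul])
  calc c * (R⁻¹ * S * I₁) = R⁻¹ * S * (c * I₁) := by ring
    _ = (R⁻¹ * R) * (S * C) := by rw [h2]; ring
    _ = c * I := by rw [inv_mul_cancel₀ hR, one_mul, h1]

end Hermitian

/-! ### Pairing tensor powers with product operators -/

section Contraction

variable {n : ℕ}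

/-- The pairing `tr (T (X₁ ⊗ ⋯ ⊗ X_t))` of an operator `T` on `(ℂ^n)^{⊗ t}` with a product
operator. -/
noncomputable def tensorPairing {t : ℕ} (X : Fin t → Matrix (Fin n) (Fin n) ℂ)
    (T : Matrix (Fin t → Fin n) (Fin t → Fin n) ℂ) : ℂ :=
  ∑ a, ∑ b, T a b * ∏ k, X k (b k) (a k)

lemma tensorPairing_tensorPow {t : ℕ} (X : Fin t → Matrix (Fin n) (Fin n) ℂ)
    (A : Matrix (Fin n) (Fin n) ℂ) :
    tensorPairing X (tensorPow t A) = ∏ k, (A * X k).trace := by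
  simp only [Matrix.trace, Matrix.diag, Matrix.mul_apply, tensorPairing, tensorPow, Matrix.of_apply]
  rw [Finset.prod_univ_sum]
  simp only [Finset.prod_univ_sum, Fintype.piFinset_univ, Finset.prod_mul_distrib]

lemma tensorPairing_sum_smul {t : ℕ} (X : Fin t → Matrix (Fin n) (Fin n) ℂ) {ι : Type*}
    [Fintype ι] (c : ι → ℂ) (T : ι → Matrix (Fin t → Fin n) (Fin t → Fin n) ℂ) :
    tensorPairing X (∑ i, c i • T i) = ∑ i, c i * tensorPairing X (T i) := by
  simp only [tensorPairing, Matrix.sum_apply, Matrix.smul_apply, smul_eq_mul, Finset.sum_mul,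
    Finset.mul_sum]
  simp only [Finset.sum_comm (s := (Finset.univ : Finset (Fin t → Fin n)))
    (t := (Finset.univ : Finset ι)), mul_assoc]

lemma isProbabilityMeasure_haarSphere [NeZero n] : IsProbabilityMeasure (haarSphere n) where
  measure_univ := by
    unfold haarSphere
    rw [Measure.smul_apply, smul_eq_mul, ENNReal.inv_mul_cancel
      (Measure.measure_univ_ne_zero.2 (Measure.toSphere_ne_zero _)) (measure_ne_top _ _)]

lemma continuous_tensorPow_proj_apply (t : ℕ) (a b : Fin t → Fin n) :
    Continuous fun ψ : unitSphere n => tensorPow t (proj ψ) a b := by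
  simp only [tensorPow, proj, Matrix.of_apply, Matrix.vecMulVec_apply]
  fun_prop

lemma tensorPairing_haarMoment [NeZero n] {t : ℕ} (X : Fin t → Matrix (Fin n) (Fin n) ℂ) :
    tensorPairing X (haarMoment n t) = ∫ ψ, ∏ k, (proj ψ * X k).trace ∂(haarSphere n) := by
  have := isProbabilityMeasure_haarSphere (n := n)
  have hint : ∀ a b : Fin t → Fin n, Integrable
      (fun ψ => tensorPow t (proj ψ) a b * ∏ k, X k (b k) (a k)) (haarSphere n) := fun a b =>
    (((continuous_tensorPow_proj_apply t a b).mul continuous_const).integrable_of_hasCompactSupport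
      (HasCompactSupport.of_compactSpace _))
  simp only [← tensorPairing_tensorPow]
  unfold tensorPairing
  rw [integral_finsetSum _ fun a _ => integrable_finsetSum _ fun b _ => hint a b]
  refine Finset.sum_congr rfl fun a _ => ?_
  rw [integral_finsetSum _ fun b _ => hint a b]
  refine Finset.sum_congr rfl fun b _ => ?_
  rw [integral_mul_const]
  rfl

lemma trace_proj_mul (ψ : unitSphere n) {X : Matrix (Fin n) (Fin n) ℂ} (hX : X.IsHermitian) :
    (proj ψ * X).trace = (quadForm X ψ.1 : ℂ) := by
  rw [ofReal_quadForm hX, proj, Matrix.vecMulVec_mul, Matrix.trace_vecMulVec,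
    Matrix.dotProduct_mulVec, dotProduct_comm]
  rfl

lemma trace_proj (ψ : unitSphere n) : (proj ψ).trace = 1 := by
  rw [proj, Matrix.trace_vecMulVec]
  have h := EuclideanSpace.inner_eq_star_dotProduct ψ.1 ψ.1
  rw [inner_self_eq_norm_sq_to_K, norm_eq_of_mem_sphere] at h
  exact h.symm.trans (by simp)

end Contraction

/-! ### Second and fourth moments on the sphere -/

section Moments

variable {n : ℕ} {Δ : Matrix (Fin n) (Fin n) ℂ}

lemma integral_quadForm_sq [NeZero n] (hΔ : Δ.IsHermitian) :
    ∫ ψ, quadForm Δ ψ.1 ^ 2 ∂(haarSphere n) =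
      ((∑ i, hΔ.eigenvalues i) ^ 2 + ∑ i, hΔ.eigenvalues i ^ 2) / (n * (n + 1)) := by
  have hn : (0 : ℝ) < n := Nat.cast_pos.2 (NeZero.pos n)
  have h1 : ∫ z, (∑ i, (1 : ℝ) * ‖z i‖ ^ 2) ^ 2
      ∂(Measure.pi fun _ : Fin n => complexGaussian) = n * (n + 1) := by
    rw [(moments_pi_complexGaussian fun _ : Fin n => (1 : ℝ)).1]
    simp
    ring
  rw [integral_haarSphere_quadForm_pow hΔ 2 (by rw [h1]; positivity), h1,
    (moments_pi_complexGaussian _).1]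

lemma integral_quadForm_pow_four [NeZero n] (hΔ : Δ.IsHermitian) :
    ∫ ψ, quadForm Δ ψ.1 ^ 4 ∂(haarSphere n) =
      ((∑ i, hΔ.eigenvalues i) ^ 4
        + 6 * (∑ i, hΔ.eigenvalues i) ^ 2 * (∑ i, hΔ.eigenvalues i ^ 2)
        + 3 * (∑ i, hΔ.eigenvalues i ^ 2) ^ 2
        + 8 * (∑ i, hΔ.eigenvalues i) * (∑ i, hΔ.eigenvalues i ^ 3)
        + 6 * ∑ i, hΔ.eigenvalues i ^ 4) / (n * (n + 1) * (n + 2) * (n + 3)) := by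
  have hn : (0 : ℝ) < n := Nat.cast_pos.2 (NeZero.pos n)
  have h1 : ∫ z, (∑ i, (1 : ℝ) * ‖z i‖ ^ 2) ^ 4
      ∂(Measure.pi fun _ : Fin n => complexGaussian) = n * (n + 1) * (n + 2) * (n + 3) := by
    rw [(moments_pi_complexGaussian fun _ : Fin n => (1 : ℝ)).2]
    simp
    ring
  rw [integral_haarSphere_quadForm_pow hΔ 4 (by rw [h1]; positivity), h1,
    (moments_pi_complexGaussian _).2]

/-- With t_k the power sums, t₄ ≤ t₂² and Cauchy–Schwarz give t₃² ≤ t₂³, so t₁t₃ ≤ (t₁² + t₂)t₂. The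
constant 81 is far from tight; its square root is the 9 of the theorem. -/
lemma fourth_moment_powerSum_le {κ : Type*} (s : Finset κ) (c : κ → ℝ) :
    (∑ i ∈ s, c i) ^ 4 + 6 * (∑ i ∈ s, c i) ^ 2 * (∑ i ∈ s, c i ^ 2)
      + 3 * (∑ i ∈ s, c i ^ 2) ^ 2 + 8 * (∑ i ∈ s, c i) * (∑ i ∈ s, c i ^ 3)
      + 6 * ∑ i ∈ s, c i ^ 4 ≤ 81 * ((∑ i ∈ s, c i) ^ 2 + ∑ i ∈ s, c i ^ 2) ^ 2 := by
  have h4 : ∑ i ∈ s, c i ^ 4 ≤ (∑ i ∈ s, c i ^ 2) ^ 2 := by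
    have := Finset.sum_sq_le_sq_sum_of_nonneg (s := s) (f := fun i => c i ^ 2)
      fun i _ => sq_nonneg _
    simpa only [← pow_mul] using this
  have h3 : (∑ i ∈ s, c i ^ 3) ^ 2 ≤ (∑ i ∈ s, c i ^ 2) * ∑ i ∈ s, c i ^ 4 := by
    have := Finset.sum_mul_sq_le_sq_mul_sq s c fun i => c i ^ 2
    simpa only [← pow_mul, ← pow_succ'] using this
  have h2 : 0 ≤ ∑ i ∈ s, c i ^ 2 := Finset.sum_nonneg fun i _ => sq_nonneg _
  generalize ∑ i ∈ s, c i = t₁ at *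
  generalize ∑ i ∈ s, c i ^ 2 = t₂ at *
  generalize ∑ i ∈ s, c i ^ 3 = t₃ at *
  generalize ∑ i ∈ s, c i ^ 4 = t₄ at *
  have h5 : (t₁ * t₃) ^ 2 ≤ ((t₁ ^ 2 + t₂) * t₂) ^ 2 := by
    have h6 : t₃ ^ 2 ≤ t₂ ^ 3 := by nlinarith
    calc (t₁ * t₃) ^ 2 = t₁ ^ 2 * t₃ ^ 2 := by ring
      _ ≤ t₁ ^ 2 * t₂ ^ 3 := by gcongr
      _ ≤ ((t₁ ^ 2 + t₂) * t₂) ^ 2 := by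
        have : 0 ≤ t₁ ^ 2 * t₂ ^ 3 := by positivity
        have : 0 ≤ t₁ ^ 4 * t₂ ^ 2 := by positivity
        have : 0 ≤ t₂ ^ 4 := by positivity
        nlinarith
  have h7 := abs_le_of_sq_le_sq h5 (by positivity)
  have h8 : 0 ≤ t₁ ^ 2 * t₂ := by positivity
  have h9 : 0 ≤ t₁ ^ 4 := by positivity
  nlinarith [(abs_le.1 h7).2, sq_nonneg t₂]

lemma integral_quadForm_pow_four_le [NeZero n] (hΔ : Δ.IsHermitian) :
    ∫ ψ, quadForm Δ ψ.1 ^ 4 ∂(haarSphere n) ≤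
      81 * (∫ ψ, quadForm Δ ψ.1 ^ 2 ∂(haarSphere n)) ^ 2 := by
  have hn : (0 : ℝ) < n := Nat.cast_pos.2 (NeZero.pos n)
  rw [integral_quadForm_sq hΔ, integral_quadForm_pow_four hΔ, div_pow, ← mul_div_assoc]
  gcongr ?_ / ?_
  · exact fourth_moment_powerSum_le _ _
  -- The denominators compare because n(n+1) ≤ (n+2)(n+3).
  · nlinarith [mul_pos hn hn, mul_pos (mul_pos hn hn) hn]

end Moments

/-- A lower bound on the first absolute moment from the second and fourth moments. -/
lemma sqrt_second_moment_le_of_fourth_moment_le {ι : Type*} [Fintype ι] {w s : ι → ℝ}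
    (hw : ∀ i, 0 ≤ w i) (h : ∑ i, w i * s i ^ 4 ≤ 81 * (∑ i, w i * s i ^ 2) ^ 2) :
    1 / 9 * √(∑ i, w i * s i ^ 2) ≤ ∑ i, w i * |s i| := by
  set a := ∑ i, w i * s i ^ 2
  have ha : 0 ≤ a := Finset.sum_nonneg fun i _ => mul_nonneg (hw i) (sq_nonneg _)
  have hL : 0 ≤ ∑ i, w i * |s i| := Finset.sum_nonneg fun i _ => mul_nonneg (hw i) (abs_nonneg _)
  obtain ha0 | ha0 := ha.eq_or_lt
  · rw [← ha0, Real.sqrt_zero, mul_zero]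
    exact hL
  set q := √a
  have hq : 0 < q := Real.sqrt_pos.2 ha0
  have hqa : q ^ 2 = a := Real.sq_sqrt ha
  -- The difference of the two sides is v(v - 9q)²(v + 18q) with v = |u|. It vanishes at v = 0 and v
  -- = 9q, the support of the extremal distribution with E v² = q² and E v⁴ = 81q⁴.
  have hpt : ∀ u : ℝ, 243 * q ^ 2 * u ^ 2 ≤ 1458 * q ^ 3 * |u| + u ^ 4 := fun u => by
    rw [← sq_abs u, ← Even.pow_abs (by decide : Even 4) u]
    have hu := abs_nonneg u
    generalize |u| = v at *
    have : 0 ≤ v * (v - 9 * q) ^ 2 * (v + 18 * q) := by positivity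
    nlinarith
  have hsum : 243 * q ^ 2 * a ≤ 1458 * q ^ 3 * ∑ i, w i * |s i| + ∑ i, w i * s i ^ 4 := by
    rw [Finset.mul_sum, Finset.mul_sum, ← Finset.sum_add_distrib]
    refine Finset.sum_le_sum fun i _ => ?_
    have := mul_le_mul_of_nonneg_left (hpt (s i)) (hw i)
    linarith
  rw [← hqa] at h hsum
  have h3 : 0 < q ^ 3 := by positivity
  -- Summing gives 243q⁴ ≤ 1458q³L + 81q⁴ with L the first absolute moment, that is q/9 ≤ L after
  -- cancelling q³.
  refine le_of_mul_le_mul_left ?_ h3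
  nlinarith

/-! ### Moments and measured norm of a design -/

section Design

variable {n : ℕ} {ι : Type*} [Fintype ι] {M : ι → Matrix (Fin n) (Fin n) ℂ}

lemma trace_mul_eq_re_of_isHermitian {A B : Matrix (Fin n) (Fin n) ℂ} (hA : A.IsHermitian)
    (hB : B.IsHermitian) : (A * B).trace = ((A * B).trace.re : ℂ) := by
  refine (Complex.conj_eq_iff_re.1 ?_).symm
  have := Matrix.trace_conjTranspose (A * B)
  rw [Matrix.conjTranspose_mul, hA.eq, hB.eq, Matrix.trace_mul_comm] at this
  exact this.symm

lemma IsDesign.trace_pos {t : ℕ} (hM : IsDesign t M) (i : ι) : 0 < (M i).trace.re := by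
  have hpsd := hM.isPOVM.posSemidef i
  have h0 := hpsd.trace_nonneg
  have hne : (M i).trace ≠ 0 := fun h => by
    have := hM.rank_eq_one i
    rw [hpsd.trace_eq_zero_iff.1 h, Matrix.rank_zero] at this
    exact zero_ne_one this
  rw [Complex.le_def] at h0
  refine lt_of_le_of_ne h0.1 fun h => hne (Complex.ext h.symm h0.2.symm)

lemma IsDesign.trace_eq_re {t : ℕ} (hM : IsDesign t M) (i : ι) :
    (M i).trace = ((M i).trace.re : ℂ) := by
  have := trace_mul_eq_re_of_isHermitian (hM.isPOVM.posSemidef i).1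
    (Matrix.isHermitian_one (n := Fin n) (α := ℂ))
  rwa [mul_one] at this

lemma IsDesign.sum_moment [NeZero n] {t : ℕ} (hM : IsDesign t M)
    (X : Fin t → Matrix (Fin n) (Fin n) ℂ) (hX : ∀ k, (X k).IsHermitian) :
    ∑ i, ((M i).trace.re / n) * ∏ k, ((M i * X k).trace.re / (M i).trace.re) =
      ∫ ψ, ∏ k, quadForm (X k) ψ.1 ∂(haarSphere n) := by
  have h := congrArg (tensorPairing X) hM.moment_eq
  rw [tensorPairing_sum_smul, tensorPairing_haarMoment] at h
  simp only [tensorPairing_tensorPow, fun ψ k => trace_proj_mul (n := n) ψ (hX k)] at h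
  simp only [← Complex.ofReal_prod, integral_complex_ofReal] at h
  rw [← Complex.ofReal_inj, ← h]
  push_cast
  refine Finset.sum_congr rfl fun i _ => ?_
  rw [← hM.trace_eq_re i]
  congr 1
  · ring
  · refine Finset.prod_congr rfl fun k _ => ?_
    rw [← trace_mul_eq_re_of_isHermitian (hM.isPOVM.posSemidef i).1 (hX k), Matrix.smul_mul,
      Matrix.trace_smul, smul_eq_mul]
    ring

lemma quadForm_one (ψ : unitSphere n) : quadForm 1 ψ.1 = 1 := by
  have h := trace_proj_mul ψ (Matrix.isHermitian_one (n := Fin n) (α := ℂ))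
  rw [mul_one, trace_proj] at h
  exact_mod_cast h.symm

lemma IsDesign.sum_sq [NeZero n] (hM : IsDesign 4 M) {Δ : Matrix (Fin n) (Fin n) ℂ}
    (hΔ : Δ.IsHermitian) :
    ∑ i, ((M i).trace.re / n) * ((M i * Δ).trace.re / (M i).trace.re) ^ 2 =
      ∫ ψ, quadForm Δ ψ.1 ^ 2 ∂(haarSphere n) := by
  -- Identity slots contribute the factor 1 on both sides: a 4-design is also a 2-design.
  have h := hM.sum_moment ![Δ, Δ, 1, 1] (fun k => by
    fin_cases k
    exacts [hΔ, hΔ, Matrix.isHermitian_one, Matrix.isHermitian_one])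
  simp only [Fin.prod_univ_four, Matrix.cons_val, mul_one, quadForm_one,
    div_self (hM.trace_pos _).ne', ← sq] at h
  exact h

lemma IsDesign.sum_pow_four [NeZero n] (hM : IsDesign 4 M) {Δ : Matrix (Fin n) (Fin n) ℂ}
    (hΔ : Δ.IsHermitian) :
    ∑ i, ((M i).trace.re / n) * ((M i * Δ).trace.re / (M i).trace.re) ^ 4 =
      ∫ ψ, quadForm Δ ψ.1 ^ 4 ∂(haarSphere n) := by
  simpa only [Finset.prod_const, Finset.card_univ, Fintype.card_fin] using
    hM.sum_moment (fun _ => Δ) fun _ => hΔ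

lemma IsDesign.measNorm_eq [NeZero n] {t : ℕ} (hM : IsDesign t M)
    {Δ : Matrix (Fin n) (Fin n) ℂ} (hΔ : Δ.IsHermitian) :
    measNorm M Δ =
      n * ∑ i, ((M i).trace.re / n) * |(M i * Δ).trace.re / (M i).trace.re| := by
  have hn : (n : ℝ) ≠ 0 := Nat.cast_ne_zero.2 (NeZero.ne n)
  rw [measNorm, Finset.mul_sum]
  refine Finset.sum_congr rfl fun i _ => ?_
  have hpos := hM.trace_pos i
  rw [trace_mul_eq_re_of_isHermitian (hM.isPOVM.posSemidef i).1 hΔ, Complex.norm_real,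
    Real.norm_eq_abs, Complex.ofReal_re, abs_div, abs_of_pos hpos]
  field_simp

/-- The measured norm of a Hermitian matrix for a `4`-design POVM. -/
theorem IsDesign.le_measNorm [NeZero n] (hM : IsDesign 4 M) {Δ : Matrix (Fin n) (Fin n) ℂ}
    (hΔ : Δ.IsHermitian) :
    1 / (9 * √(1 + 1 / (n : ℝ))) * √(Δ.trace.re ^ 2 + (Δ ^ 2).trace.re) ≤ measNorm M Δ := by
  have hn : (0 : ℝ) < n := Nat.cast_pos.2 (NeZero.pos n)
  have h := sqrt_second_moment_le_of_fourth_moment_le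
    (w := fun i => (M i).trace.re / n) (s := fun i => (M i * Δ).trace.re / (M i).trace.re)
    (fun i => div_nonneg (hM.trace_pos i).le hn.le) (by
      rw [hM.sum_sq hΔ, hM.sum_pow_four hΔ]
      exact integral_quadForm_pow_four_le hΔ)
  rw [hM.sum_sq hΔ, integral_quadForm_sq hΔ] at h
  rw [hM.measNorm_eq hΔ]
  refine le_trans (le_of_eq ?_) (mul_le_mul_of_nonneg_left h hn.le)
  have h1 : Δ.trace.re = ∑ i, hΔ.eigenvalues i := by
    have := sum_eigenvalues_pow hΔ 1
    simp only [pow_one] at this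
    rw [← this, Complex.ofReal_re]
  rw [h1, ← sum_eigenvalues_pow hΔ 2, Complex.ofReal_re]
  have h2 : (n : ℝ) * (n + 1) = n ^ 2 * (1 + 1 / n) := by field_simp
  rw [h2, Real.sqrt_div' _ (by positivity), Real.sqrt_mul (by positivity), Real.sqrt_sq hn.le]
  field_simp

end Design

end QuantumDesign

/-! ### The bound for a pair of states -/

theorem mainTheorem2 {n : ℕ} {ι : Type*} [Fintype ι]
    (M : ι → Matrix (Fin n) (Fin n) ℂ) (hM : QuantumDesign.IsDesign 4 M)
    (ρ σ : Matrix (Fin n) (Fin n) ℂ)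
    (hρ : QuantumDesign.IsState ρ) (hσ : QuantumDesign.IsState σ)
    (p : ℝ) (hp0 : 0 ≤ p) (hp1 : p ≤ 1)
    (Δ : Matrix (Fin n) (Fin n) ℂ) (hΔ : Δ = (p : ℂ) • ρ - (1 - (p : ℂ)) • σ) :
    QuantumDesign.measNorm M Δ ≥
      1 / (9 * Real.sqrt (1 + 1 / (n : ℝ))) *
        Real.sqrt ((1 - 2 * p) ^ 2 + (Δ ^ 2).trace.re) := by
  -- A 0×0 matrix has trace 0, so a state forces n ≥ 1.
  have : NeZero n := ⟨by
    rintro rfl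
    have := hρ.trace_eq_one
    simp at this⟩
  have hherm : Δ.IsHermitian := by
    rw [Matrix.IsHermitian, hΔ, Matrix.conjTranspose_sub, Matrix.conjTranspose_smul,
      Matrix.conjTranspose_smul, hρ.posSemidef.1.eq, hσ.posSemidef.1.eq]
    simp
  have htr : Δ.trace.re = 2 * p - 1 := by
    rw [hΔ, Matrix.trace_sub, Matrix.trace_smul, Matrix.trace_smul, hρ.trace_eq_one,
      hσ.trace_eq_one]
    simp
    ring
  have h := hM.le_measNorm hherm
  rw [htr] at h
  have hsq : (1 - 2 * p) ^ 2 = (2 * p - 1) ^ 2 := by ring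
  rw [hsq]
  exact h
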